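/- **Suslin sets.** For a finite sequence $s$ of natural numbers let $\langle s\rangle\in\mathbb N$ be its sequence number (under a fixed computable bijection of the finite sequences with $\mathbb N$), and let $\bar f(n)=\langle f(0),\dots,f(n-1)\rangle$. For a topological space $X$ and a family $\mathbf P=(P_s)$ of subsets of $X$ indexed by the finite sequences of natural numbers, put $\mathbf A(\mathbf P)=\bigcup_{f\in\mathbb N^{\mathbb N}}\bigcap_{n\in\mathbb N}P_{\bar f(n)}$. Let $\Sigma_0$ be the class of clopen subsets of $X$; for $\alpha>0$ let $\Sigma_\alpha$ be the class of all $\mathbf A(\mathbf P)$ such that each $P_s$ lies in $\Pi_\beta$ for some $\beta<\alpha$ (which may depend on $s$); and let $\Pi_\alpha=\{X\setminus P : P\in\Sigma_\alpha\}$. A *Suslin set* is an element of $\Sigma_\alpha$ for some countable ordinal $\alpha$. **Computations in $\mathbf S$.** The Suslin functional $\mathbf S:\mathbb N^{\mathbb N}\to\{0,1\}$ is given by $\mathbf S(g)=0$ if $\forall f\in\mathbb N^{\mathbb N}\,\exists n\; g(\bar f(n))=0$, and $\mathbf S(g)=1$ otherwise. The relation $\{e\}(\mathbf S,\vec a,\vec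 f)=b$, with $e,b\in\mathbb N$, $\vec a$ a finite sequence of natural numbers and $\vec f$ a finite sequence from $\mathbb N^{\mathbb N}$, is defined inductively by Kleene's schemes, that is, $\Omega_{\mathbf S}$ is the least set of tuples $\langle e,\vec a,\vec f,b\rangle$ closed under them: - S1: $\{\langle 1\rangle\}(\mathbf S,x,\vec a,\vec f)=x+1$. - S2: $\{\langle 2,q\rangle\}(\mathbf S,\vec a,\vec f)=q$. - S3: $\{\langle 3\rangle\}(\mathbf S,x,\vec a,\vec f)=x$. - S4: $\{\langle 4,e_1,e_2\rangle\}(\mathbf S,\vec a,\vec f)\simeq\{e_1\}(\mathbf S,\{e_2\}(\mathbf S,\vec a,\vec f),\vec a,\vec f)$. - S5: for $e=\langle 5,e_1,e_2\rangle$, $\{e\}(\mathbf S,0,\vec a,\vec f)\simeq\{e_1\}(\mathbf S,\vec a,\vec f)$ and $\{e\}(\mathbf S,x+1,\vec a,\vec f)\simeq\{e_2\}(\mathbf S,x,\{e\}(\mathbf S,x,\vec a,\vec f),\vec a,\vec f)$. - S6: $\{\langle 6,e_1,\langle\sigma\rangle,\langle\tau\rangle\rangle\}(\mathbf S,\vec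 a,\vec f)\simeq\{e_1\}(\mathbf S,\vec a_\sigma,\vec f_\tau)$, where $\sigma,\tau$ are permutations of the positions in $\vec a$ and in $\vec f$, and $\vec a_\sigma=(a_{\sigma(0)},a_{\sigma(1)},\dots)$, $\vec f_\tau=(f_{\tau(0)},f_{\tau(1)},\dots)$. - S7: $\{\langle 7\rangle\}(\mathbf S,x,\vec a,g,\vec f)=g(x)$. - S8: $\{\langle 8,e_1\rangle\}(\mathbf S,\vec a,\vec f)\simeq\mathbf S(\lambda x.\{e_1\}(\mathbf S,x,\vec a,\vec f))$, defined only if $\lambda x.\{e_1\}(\mathbf S,x,\vec a,\vec f)$ is total. - S9: $\{\langle 9,i,j\rangle\}(\mathbf S,x,\vec a,\vec f)\simeq\{x\}(\mathbf S,\vec a',\vec f')$, where $\vec a'$ consists of the first $i$ entries of $\vec a$ and $\vec f'$ of the first $j$ entries of $\vec f$ ($i$ and $j$ not exceeding the respective lengths). The rank $\|\cdot\|_{\Omega_{\mathbf S}}$ is the ordinal rank of this inductive definition: the rank of a computation in $\Omega_{\mathbf S}$ is the least ordinal greater than the ranks of all its immediate subcomputations (so initial computations have rank $0$), and a tuple outside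 $\Omega_{\mathbf S}$ has rank $\infty$, above all ordinals. **Theorem.** Let $\alpha$ be a countable ordinal. For all $e,k,b\in\mathbb N$ and every finite sequence $\vec a$ of natural numbers, the set $$\{\vec f\in(\mathbb N^{\mathbb N})^k \;:\; \|\langle e,\vec a,\vec f,b\rangle\|_{\Omega_{\mathbf S}}<\alpha\}$$ is a Suslin subset of $(\mathbb N^{\mathbb N})^k$ (with the product topology, $\mathbb N$ discrete). -/

import Mathlib

/-! ### The Suslin operator and the Suslin hierarchy -/

/-- The initial segment `⟨f 0, …, f (n-1)⟩` of `f`. -/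
def initSeg (f : ℕ → ℕ) (n : ℕ) : List ℕ := (List.range n).map f

/-- The Suslin operator: `A(P) = ⋃ f, ⋂ n, P_{⟨f 0, …, f (n-1)⟩}`. -/
def suslinOp {X : Type} (P : List ℕ → Set X) : Set X :=
  ⋃ f : ℕ → ℕ, ⋂ n : ℕ, P (initSeg f n)

/-- The class `Σ_α` of subsets of `X`. `Σ_0` is the class of clopen sets; for `α > 0`, `Σ_α` is the
class of all `A(P)` with every `P s` the complement of a set in some `Σ_β`, where `β < α` may
depend on `s`. -/
def SigmaClass (X : Type) [TopologicalSpace X] (α : Ordinal.{0}) : Set (Set X) :=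
  {A | (α = 0 ∧ IsClopen A) ∨
    (0 < α ∧ ∃ P : List ℕ → Set X,
      (∀ s, ∃ β, ∃ _ : β < α, ∃ Q ∈ SigmaClass X β, P s = Qᶜ) ∧ A = suslinOp P)}
termination_by α

/-- A Suslin set is a member of `Σ_α` for some countable ordinal `α`. -/
def IsSuslinSet {X : Type} [TopologicalSpace X] (A : Set X) : Prop :=
  ∃ α : Ordinal.{0}, α.card ≤ Cardinal.aleph0 ∧ A ∈ SigmaClass X α

/-! ### Kleene computations relative to the Suslin functional -/

/-- The sequence number `⟨s⟩` of a finite sequence of natural numbers: a computable bijection from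
finite sequences onto `ℕ`. -/
def seqNum (s : List ℕ) : ℕ := Encodable.encode s

open Classical in
/-- The Suslin functional: `S(g) = 0` if for every `f` there is `n` with `g (f̄ n) = 0`, and
`S(g) = 1` otherwise, that is, if there is `f` with `g (f̄ n) > 0` for all `n`. -/
noncomputable def suslinFunctional (g : ℕ → ℕ) : ℕ :=
  if ∀ f : ℕ → ℕ, ∃ n : ℕ, g (seqNum (initSeg f n)) = 0 then 0 else 1

/-- A sequence `⟨e, a, f, b⟩`, read as the assertion `{e}(S, a, f) = b`. -/
structure CompSeq where
  idx : ℕ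
  ints : List ℕ
  funs : List (ℕ → ℕ)
  val : ℕ

/-- One application of Kleene's schemes S1 - S9 for computations relative to the Suslin functional:
`KleeneStep R x` says that `x` is obtained by one of the schemes from immediate subcomputations
that all belong to `R`. -/
inductive KleeneStep (R : Set CompSeq) : CompSeq → Prop
  /-- Successor: `{e}(S, x, a, f) = x + 1` for `e = ⟨1⟩`. -/
  | s1 (x : ℕ) (a : List ℕ) (f : List (ℕ → ℕ)) :
      KleeneStep R ⟨seqNum [1], x :: a, f, x + 1⟩
  /-- Constants: `{e}(S, a, f) = q` for `e = ⟨2, q⟩`. -/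
  | s2 (q : ℕ) (a : List ℕ) (f : List (ℕ → ℕ)) :
      KleeneStep R ⟨seqNum [2, q], a, f, q⟩
  /-- Projection: `{e}(S, x, a, f) = x` for `e = ⟨3⟩`. -/
  | s3 (x : ℕ) (a : List ℕ) (f : List (ℕ → ℕ)) :
      KleeneStep R ⟨seqNum [3], x :: a, f, x⟩
  /-- Composition: `{e}(S, a, f) ≃ {e₁}(S, {e₂}(S, a, f), a, f)` for `e = ⟨4, e₁, e₂⟩`. -/
  | s4 (e₁ e₂ : ℕ) (a : List ℕ) (f : List (ℕ → ℕ)) (c b : ℕ)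
      (h₂ : ⟨e₂, a, f, c⟩ ∈ R) (h₁ : ⟨e₁, c :: a, f, b⟩ ∈ R) :
      KleeneStep R ⟨seqNum [4, e₁, e₂], a, f, b⟩
  /-- Primitive recursion, `e = ⟨5, e₁, e₂⟩`, at zero: `{e}(S, 0, a, f) ≃ {e₁}(S, a, f)`. -/
  | s5_zero (e₁ e₂ : ℕ) (a : List ℕ) (f : List (ℕ → ℕ)) (b : ℕ)
      (h₁ : ⟨e₁, a, f, b⟩ ∈ R) :
      KleeneStep R ⟨seqNum [5, e₁, e₂], 0 :: a, f, b⟩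
  /-- Primitive recursion, `e = ⟨5, e₁, e₂⟩`, at a successor:
  `{e}(S, x + 1, a, f) ≃ {e₂}(S, x, {e}(S, x, a, f), a, f)`. -/
  | s5_succ (e₁ e₂ x : ℕ) (a : List ℕ) (f : List (ℕ → ℕ)) (c b : ℕ)
      (h : ⟨seqNum [5, e₁, e₂], x :: a, f, c⟩ ∈ R) (h₂ : ⟨e₂, x :: c :: a, f, b⟩ ∈ R) :
      KleeneStep R ⟨seqNum [5, e₁, e₂], (x + 1) :: a, f, b⟩
  /-- Permutation of the integer arguments and of the function arguments: for
  `e = ⟨6, e₁, ⟨σ⟩, ⟨τ⟩⟩` with `σ` and `τ` listing permutations of the positions,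
  `{e}(S, a, f) ≃ {e₁}(S, a_{σ 0}, a_{σ 1}, …, f_{τ 0}, f_{τ 1}, …)`. -/
  | s6 (e₁ : ℕ) (σ τ : List ℕ) (a : List ℕ) (f : List (ℕ → ℕ)) (b : ℕ)
      (hσ : σ.Perm (List.range a.length)) (hτ : τ.Perm (List.range f.length))
      (h₁ : ⟨e₁, σ.map (fun i => a.getD i 0), τ.map (fun i => f.getD i 0), b⟩ ∈ R) :
      KleeneStep R ⟨seqNum [6, e₁, seqNum σ, seqNum τ], a, f, b⟩
  /-- Application of a function argument: `{e}(S, x, a, g, f) = g x` for `e = ⟨7⟩`. -/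
  | s7 (x : ℕ) (a : List ℕ) (g : ℕ → ℕ) (f : List (ℕ → ℕ)) :
      KleeneStep R ⟨seqNum [7], x :: a, g :: f, g x⟩
  /-- Application of `S`: `{e}(S, a, f) ≃ S(λ x, {e₁}(S, x, a, f))` for `e = ⟨8, e₁⟩`, which is
  defined only if `λ x, {e₁}(S, x, a, f)` is total. -/
  | s8 (e₁ : ℕ) (a : List ℕ) (f : List (ℕ → ℕ)) (g : ℕ → ℕ)
      (h₁ : ∀ x, ⟨e₁, x :: a, f, g x⟩ ∈ R) :
      KleeneStep R ⟨seqNum [8, e₁], a, f, suslinFunctional g⟩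
  /-- Enumeration: `{e}(S, x, a, f) ≃ {x}(S, a', f')` for `e = ⟨9, i, j⟩`, where `a'` consists of
  the first `i` terms of `a` and `f'` of the first `j` terms of `f`. -/
  | s9 (i j x : ℕ) (a : List ℕ) (f : List (ℕ → ℕ)) (b : ℕ)
      (hi : i ≤ a.length) (hj : j ≤ f.length)
      (h : ⟨x, a.take i, f.take j, b⟩ ∈ R) :
      KleeneStep R ⟨seqNum [9, i, j], x :: a, f, b⟩

/-- The set `Ω_S` of all `⟨e, a, f, b⟩` with `{e}(S, a, f) = b`: the least set closed under the
schemes. -/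
def OmegaS : Set CompSeq := ⋂₀ {R : Set CompSeq | ∀ x, KleeneStep R x → x ∈ R}

/-- The stages of the inductive definition of `Ω_S`: stage `α` consists of the computations all of
whose immediate subcomputations occur at stages before `α`. -/
def OmegaStage (α : Ordinal.{0}) : Set CompSeq :=
  {x | KleeneStep {y | ∃ β, ∃ _ : β < α, y ∈ OmegaStage β} x}
termination_by α

open Classical in
/-- The ordinal rank on `Ω_S`: the first stage at which a computation occurs. Thus initial
computations have rank `0`, and any other computation has the least rank above the ranks of its
immediate subcomputations. The rank is `⊤` outside `Ω_S`. -/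
noncomputable def rankS (x : CompSeq) : WithTop Ordinal.{0} :=
  if x ∈ OmegaS then ((sInf {α : Ordinal.{0} | x ∈ OmegaStage α} : Ordinal.{0}) :
    WithTop Ordinal.{0}) else ⊤

/-! ### Closure properties of the Suslin sets -/

/-! Suslin sets are closed under complement, countable unions and intersections, the Suslin operator
and continuous preimages. By induction on countable `α`, the sections of `OmegaStage α` with fixed
number entries are Suslin: such a stage is one application of the schemes to a countable union of
earlier stages. Every scheme but S8 uses only countable quantifiers over number data, with
continuous rearrangements of the function arguments. S8 quantifies over all `g : ℕ → ℕ`;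
`exists_suslinFunctional_eq_iff` trades this for countable quantifiers and one quantifier over
branches, which is the Suslin operator or its dual. `HasSuslinSections.kleeneStep` assembles the
cases. -/

theorem suslinOp_const {X : Type} (A : Set X) : suslinOp (fun _ => A) = A := by
  ext x
  simp [suslinOp]

theorem preimage_suslinOp {X Y : Type} (φ : Y → X) (P : List ℕ → Set X) :
    φ ⁻¹' suslinOp P = suslinOp (fun s => φ ⁻¹' P s) := by
  simp only [suslinOp, Set.preimage_iUnion, Set.preimage_iInter]

theorem length_initSeg (f : ℕ → ℕ) (n : ℕ) : (initSeg f n).length = n := by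
  simp [initSeg]

section SuslinClosure

variable {X : Type} [TopologicalSpace X]

theorem mem_sigmaClass_zero {A : Set X} (hA : IsClopen A) : A ∈ SigmaClass X 0 := by
  rw [SigmaClass]
  exact Or.inl ⟨rfl, hA⟩

theorem suslinOp_mem_sigmaClass {α : Ordinal.{0}} {P : List ℕ → Set X}
    (hP : ∀ s, ∃ β < α, (P s)ᶜ ∈ SigmaClass X β) : suslinOp P ∈ SigmaClass X α := by
  obtain ⟨β, hβ, -⟩ := hP []
  rw [SigmaClass]
  refine Or.inr ⟨lt_of_le_of_lt (zero_le (a := β)) hβ, P, fun s => ?_, rfl⟩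
  obtain ⟨γ, hγ, h⟩ := hP s
  exact ⟨γ, hγ, _, h, (compl_compl _).symm⟩

theorem compl_mem_sigmaClass {α β : Ordinal.{0}} (h : β < α) {A : Set X}
    (hA : A ∈ SigmaClass X β) : Aᶜ ∈ SigmaClass X α := by
  rw [← suslinOp_const Aᶜ]
  exact suslinOp_mem_sigmaClass fun _ => ⟨β, h, by rwa [compl_compl]⟩

namespace IsSuslinSet

theorem of_isClopen {A : Set X} (hA : IsClopen A) : IsSuslinSet A :=
  ⟨0, by simp, mem_sigmaClass_zero hA⟩

theorem const (p : Prop) : IsSuslinSet {_x : X | p} := by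
  by_cases hp : p <;> simp only [hp]
  · exact of_isClopen isClopen_univ
  · exact of_isClopen isClopen_empty

theorem compl {A : Set X} (hA : IsSuslinSet A) : IsSuslinSet Aᶜ := by
  obtain ⟨α, hα, h⟩ := hA
  exact ⟨α + 1, by simpa using hα, compl_mem_sigmaClass (Order.lt_add_one_iff.2 le_rfl) h⟩

theorem suslinOp {P : List ℕ → Set X} (hP : ∀ s, IsSuslinSet (P s)) :
    IsSuslinSet (suslinOp P) := by
  -- Levels are chosen for the complements, as the hierarchy demands; a countable supremum of
  -- countable ordinals is countable.
  choose α hα h using fun s => (hP s).compl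
  refine ⟨⨆ s, (α s + 1), Ordinal.card_iSup_le (Cardinal.mk_le_aleph0) fun s => ?_,
    suslinOp_mem_sigmaClass fun s => ⟨α s, ?_, h s⟩⟩
  · simpa using hα s
  · exact lt_of_lt_of_le (Order.lt_add_one_iff.2 le_rfl) (Ordinal.le_iSup (fun s => α s + 1) s)

theorem preimage {Y : Type} [TopologicalSpace Y] {φ : Y → X} (hφ : Continuous φ) {A : Set X}
    (hA : IsSuslinSet A) : IsSuslinSet (φ ⁻¹' A) := by
  obtain ⟨α, hα, h⟩ := hA
  refine ⟨α, hα, ?_⟩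
  -- Preimages preserve the level itself, so the induction can run over all ordinals.
  clear hα
  induction α using WellFoundedLT.induction generalizing A with
  | ind α ih =>
    rw [SigmaClass] at h
    rcases h with ⟨rfl, hA⟩ | ⟨-, P, hP, rfl⟩
    · exact mem_sigmaClass_zero (hA.preimage hφ)
    · rw [preimage_suslinOp]
      refine suslinOp_mem_sigmaClass fun s => ?_
      obtain ⟨β, hβ, Q, hQ, hPQ⟩ := hP s
      exact ⟨β, hβ, by simpa [hPQ] using ih β hβ hQ⟩

/-- If the family depends only on the length of `s`, every branch gives the same intersection. -/
theorem iInter_nat {A : ℕ → Set X} (hA : ∀ n, IsSuslinSet (A n)) : IsSuslinSet (⋂ n, A n) := by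
  have : ⋂ n, A n = _root_.suslinOp (fun s => A s.length) := by
    simp [_root_.suslinOp, length_initSeg, Set.iUnion_const]
  rw [this]
  exact suslinOp fun s => hA _

theorem forall_countable {ι : Type*} [Countable ι] {p : ι → X → Prop}
    (h : ∀ i, IsSuslinSet {x | p i x}) : IsSuslinSet {x | ∀ i, p i x} := by
  cases isEmpty_or_nonempty ι
  · simpa using const (X := X) True
  · obtain ⟨u, hu⟩ := exists_surjective_nat ι
    have : {x | ∀ i, p i x} = ⋂ n, {x | p (u n) x} := by
      ext x
      simp [hu.forall]
    rw [this]
    exact iInter_nat fun n => h _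

theorem exists_countable {ι : Type*} [Countable ι] {p : ι → X → Prop}
    (h : ∀ i, IsSuslinSet {x | p i x}) : IsSuslinSet {x | ∃ i, p i x} := by
  have := (forall_countable (p := fun i x => ¬ p i x) fun i => (h i).compl).compl
  simpa [Set.compl_ofPred] using this

theorem and {p q : X → Prop} (hp : IsSuslinSet {x | p x}) (hq : IsSuslinSet {x | q x}) :
    IsSuslinSet {x | p x ∧ q x} := by
  have := forall_countable (p := fun (i : Bool) x => cond i (p x) (q x))
    (fun i => by cases i <;> assumption)
  simpa [and_comm] using this

theorem or {p q : X → Prop} (hp : IsSuslinSet {x | p x}) (hq : IsSuslinSet {x | q x}) :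
    IsSuslinSet {x | p x ∨ q x} := by
  have := exists_countable (p := fun (i : Bool) x => cond i (p x) (q x))
    (fun i => by cases i <;> assumption)
  simpa [or_comm] using this

theorem exists_branch {p : ℕ → X → Prop} (h : ∀ n, IsSuslinSet {x | p n x}) :
    IsSuslinSet {x | ∃ u : ℕ → ℕ, ∀ n, p (seqNum (initSeg u n)) x} := by
  have : {x | ∃ u : ℕ → ℕ, ∀ n, p (seqNum (initSeg u n)) x} =
      _root_.suslinOp (fun s => {x | p (seqNum s) x}) := by
    ext x
    simp [_root_.suslinOp]
  rw [this]
  exact suslinOp fun s => h _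

theorem forall_branch {p : ℕ → X → Prop} (h : ∀ n, IsSuslinSet {x | p n x}) :
    IsSuslinSet {x | ∀ u : ℕ → ℕ, ∃ n, p (seqNum (initSeg u n)) x} := by
  have := (exists_branch (p := fun n x => ¬ p n x) fun n => (h n).compl).compl
  simpa [Set.compl_ofPred] using this

end IsSuslinSet

end SuslinClosure

/-! ### Stages and ranks -/

theorem KleeneStep.mono {R R' : Set CompSeq} (h : R ⊆ R') {x : CompSeq} (hx : KleeneStep R x) :
    KleeneStep R' x := by
  cases hx with
  | s1 => exact .s1 ..
  | s2 => exact .s2 ..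
  | s3 => exact .s3 ..
  | s4 e₁ e₂ a f c b h₂ h₁ => exact .s4 _ _ _ _ c _ (h h₂) (h h₁)
  | s5_zero e₁ e₂ a f b h₁ => exact .s5_zero _ _ _ _ _ (h h₁)
  | s5_succ e₁ e₂ x a f c b h₁ h₂ => exact .s5_succ _ _ _ _ _ c _ (h h₁) (h h₂)
  | s6 e₁ σ τ a f b hσ hτ h₁ => exact .s6 _ _ _ _ _ _ hσ hτ (h h₁)
  | s7 => exact .s7 ..
  | s8 e₁ a f g h₁ => exact .s8 _ _ _ _ fun x => h (h₁ x)
  | s9 i j x a f b hi hj h₁ => exact .s9 _ _ _ _ _ _ hi hj (h h₁)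

theorem mem_omegaStage_iff {α : Ordinal.{0}} {x : CompSeq} :
    x ∈ OmegaStage α ↔ KleeneStep {y | ∃ β < α, y ∈ OmegaStage β} x := by
  rw [OmegaStage]
  simp

theorem omegaStage_subset_omegaS (α : Ordinal.{0}) : OmegaStage α ⊆ OmegaS := by
  induction α using WellFoundedLT.induction with
  | ind α ih =>
    intro x hx R hR
    refine hR x ((mem_omegaStage_iff.1 hx).mono ?_)
    rintro y ⟨β, hβ, hy⟩
    exact ih β hβ hy R hR

/-- The union of all stages is closed under the schemes: `CompSeq` is a small type, so some ordinal
exceeds the first stages of all its elements. -/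
theorem exists_mem_omegaStage {x : CompSeq} (hx : x ∈ OmegaS) : ∃ α, x ∈ OmegaStage α := by
  refine Set.mem_sInter.1 hx {y | ∃ α, y ∈ OmegaStage α} fun z hz => ?_
  -- For `y` in no stage this is the junk value `sInf ∅ = 0`, which is harmless.
  let ρ : CompSeq → Ordinal.{0} := fun y => sInf {α | y ∈ OmegaStage α}
  refine ⟨⨆ y, (ρ y + 1), mem_omegaStage_iff.2 (hz.mono ?_)⟩
  intro y hy
  refine ⟨ρ y, ?_, csInf_mem (s := {α | y ∈ OmegaStage α}) hy⟩
  exact lt_of_lt_of_le (Order.lt_add_one_iff.2 le_rfl) (Ordinal.le_iSup (fun y => ρ y + 1) y)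

theorem rankS_lt_coe_iff {x : CompSeq} {α : Ordinal.{0}} :
    rankS x < (α : WithTop Ordinal.{0}) ↔ ∃ β < α, x ∈ OmegaStage β := by
  unfold rankS
  split_ifs with h
  · rw [WithTop.coe_lt_coe]
    constructor
    · exact fun hlt => ⟨_, hlt, csInf_mem (exists_mem_omegaStage h)⟩
    · rintro ⟨β, hβ, hx⟩
      exact lt_of_le_of_lt (csInf_le' hx) hβ
  · simp only [not_top_lt, false_iff]
    rintro ⟨β, -, hx⟩
    exact h (omegaStage_subset_omegaS β hx)

/-! ### Kleene's schemes preserve Suslin sections -/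

/-- No uniqueness of values is needed: when `R` is multivalued, choose the value `0` as often as
possible. -/
theorem exists_suslinFunctional_eq_zero_iff {V : ℕ → ℕ → Prop} :
    (∃ g : ℕ → ℕ, (∀ x, V x (g x)) ∧ suslinFunctional g = 0) ↔
      (∀ x, ∃ c, V x c) ∧ ∀ u : ℕ → ℕ, ∃ n, V (seqNum (initSeg u n)) 0 := by
  constructor
  · rintro ⟨g, hg, h0⟩
    refine ⟨fun x => ⟨_, hg x⟩, fun u => ?_⟩
    by_cases hS : ∀ f : ℕ → ℕ, ∃ n : ℕ, g (seqNum (initSeg f n)) = 0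
    · obtain ⟨n, hn⟩ := hS u
      exact ⟨n, hn ▸ hg _⟩
    · simp [suslinFunctional, hS] at h0
  · rintro ⟨ht, hu⟩
    have : ∀ x, ∃ c, V x c ∧ (V x 0 → c = 0) := fun x => by
      by_cases h : V x 0
      · exact ⟨0, h, fun _ => rfl⟩
      · obtain ⟨c, hc⟩ := ht x
        exact ⟨c, hc, fun h' => absurd h' h⟩
    choose g hg hg0 using this
    refine ⟨g, hg, if_pos fun f => ?_⟩
    obtain ⟨n, hn⟩ := hu f
    exact ⟨n, hg0 _ hn⟩

/-- Dually, choose a positive value whenever one is available; the given branch then never meets a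
zero of `g`. -/
theorem exists_suslinFunctional_eq_one_iff {V : ℕ → ℕ → Prop} :
    (∃ g : ℕ → ℕ, (∀ x, V x (g x)) ∧ suslinFunctional g = 1) ↔
      (∀ x, ∃ c, V x c) ∧ ∃ u : ℕ → ℕ, ∀ n, ∃ c, V (seqNum (initSeg u n)) (c + 1) := by
  constructor
  · rintro ⟨g, hg, h1⟩
    refine ⟨fun x => ⟨_, hg x⟩, ?_⟩
    by_cases hS : ∀ f : ℕ → ℕ, ∃ n : ℕ, g (seqNum (initSeg f n)) = 0
    · simp [suslinFunctional, hS] at h1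
    · push Not at hS
      obtain ⟨u, hu⟩ := hS
      refine ⟨u, fun n => ?_⟩
      obtain ⟨c, hc⟩ := Nat.exists_eq_succ_of_ne_zero (hu n)
      exact ⟨c, by simpa [hc] using hg (seqNum (initSeg u n))⟩
  · rintro ⟨ht, u, hu⟩
    have : ∀ x, ∃ c, V x c ∧ ((∃ d, V x (d + 1)) → c ≠ 0) := fun x => by
      by_cases h : ∃ d, V x (d + 1)
      · obtain ⟨d, hd⟩ := h
        exact ⟨d + 1, hd, fun _ => d.succ_ne_zero⟩
      · obtain ⟨c, hc⟩ := ht x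
        exact ⟨c, hc, fun h' => absurd h' h⟩
    choose g hg hg0 using this
    refine ⟨g, hg, if_neg fun h => ?_⟩
    obtain ⟨n, hn⟩ := h u
    exact hg0 _ (hu n) hn

theorem exists_suslinFunctional_eq_iff {V : ℕ → ℕ → Prop} {b : ℕ} :
    (∃ g : ℕ → ℕ, (∀ x, V x (g x)) ∧ suslinFunctional g = b) ↔
      (∀ x, ∃ c, V x c) ∧ ((b = 0 ∧ ∀ u : ℕ → ℕ, ∃ n, V (seqNum (initSeg u n)) 0) ∨
        (b = 1 ∧ ∃ u : ℕ → ℕ, ∀ n, ∃ c, V (seqNum (initSeg u n)) (c + 1))) := by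
  match b with
  | 0 => simpa using exists_suslinFunctional_eq_zero_iff
  | 1 => simpa using exists_suslinFunctional_eq_one_iff
  | b + 2 =>
    simp only [Nat.add_eq_zero_iff, OfNat.ofNat_ne_zero, and_false, false_and,
      Nat.reduceEqDiff, or_self, iff_false]
    rintro ⟨g, -, h⟩
    unfold suslinFunctional at h
    split_ifs at h
    omega

/-- Inversion of the schemes, arranged so that in each disjunct the conditions not involving the
entries of `f` are separate and define constant sets. For S7, `getD` replaces a decomposition of
`f`, making the dependence on `f` visibly continuous. -/
theorem kleeneStep_iff {R : Set CompSeq} {e : ℕ} {a : List ℕ} {f : List (ℕ → ℕ)} {b : ℕ} :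
    KleeneStep R ⟨e, a, f, b⟩ ↔
      ((∃ x a', e = seqNum [1] ∧ a = x :: a' ∧ b = x + 1) ∨
        e = seqNum [2, b] ∨
        (∃ a', e = seqNum [3] ∧ a = b :: a')) ∨
      (∃ e₁ e₂ c, e = seqNum [4, e₁, e₂] ∧ ⟨e₂, a, f, c⟩ ∈ R ∧ ⟨e₁, c :: a, f, b⟩ ∈ R) ∨
      (∃ e₁ e₂ a', (e = seqNum [5, e₁, e₂] ∧ a = 0 :: a') ∧ ⟨e₁, a', f, b⟩ ∈ R) ∨
      (∃ e₁ e₂ x a' c, (e = seqNum [5, e₁, e₂] ∧ a = (x + 1) :: a') ∧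
        ⟨seqNum [5, e₁, e₂], x :: a', f, c⟩ ∈ R ∧ ⟨e₂, x :: c :: a', f, b⟩ ∈ R) ∨
      (∃ e₁ σ τ, (e = seqNum [6, e₁, seqNum σ, seqNum τ] ∧ σ.Perm (List.range a.length) ∧
        τ.Perm (List.range f.length)) ∧
        ⟨e₁, σ.map (fun i => a.getD i 0), τ.map (fun i => f.getD i 0), b⟩ ∈ R) ∨
      (∃ x a', (e = seqNum [7] ∧ a = x :: a' ∧ 0 < f.length) ∧ f.getD 0 0 x = b) ∨
      (∃ e₁, e = seqNum [8, e₁] ∧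
        ∃ g : ℕ → ℕ, (∀ x, ⟨e₁, x :: a, f, g x⟩ ∈ R) ∧ suslinFunctional g = b) ∨
      (∃ i j x a', (e = seqNum [9, i, j] ∧ a = x :: a' ∧ i ≤ a'.length ∧ j ≤ f.length) ∧
        ⟨x, a'.take i, f.take j, b⟩ ∈ R) := by
  constructor
  · intro h
    cases h with
    | s1 x a => exact .inl (.inl ⟨x, a, rfl, rfl, rfl⟩)
    | s2 => exact .inl (.inr (.inl rfl))
    | s3 x a => exact .inl (.inr (.inr ⟨a, rfl, rfl⟩))
    | s4 e₁ e₂ a f c b h₂ h₁ => exact .inr (.inl ⟨e₁, e₂, c, rfl, h₂, h₁⟩)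
    | s5_zero e₁ e₂ a f b h₁ => exact .inr (.inr (.inl ⟨e₁, e₂, a, ⟨rfl, rfl⟩, h₁⟩))
    | s5_succ e₁ e₂ x a f c b h h₂ =>
      exact .inr (.inr (.inr (.inl ⟨e₁, e₂, x, a, c, ⟨rfl, rfl⟩, h, h₂⟩)))
    | s6 e₁ σ τ a f b hσ hτ h₁ =>
      exact .inr (.inr (.inr (.inr (.inl ⟨e₁, σ, τ, ⟨rfl, hσ, hτ⟩, h₁⟩))))
    | s7 x a g f =>
      exact .inr (.inr (.inr (.inr (.inr (.inl ⟨x, a, ⟨rfl, rfl, by simp⟩, rfl⟩)))))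
    | s8 e₁ a f g h₁ =>
      exact .inr (.inr (.inr (.inr (.inr (.inr (.inl ⟨e₁, rfl, g, h₁, rfl⟩))))))
    | s9 i j x a f b hi hj h =>
      exact .inr (.inr (.inr (.inr (.inr (.inr (.inr ⟨i, j, x, a, ⟨rfl, rfl, hi, hj⟩, h⟩))))))
  · rintro ((⟨x, a, rfl, rfl, rfl⟩ | rfl | ⟨a, rfl, rfl⟩) | ⟨e₁, e₂, c, rfl, h₂, h₁⟩ |
      ⟨e₁, e₂, a, ⟨rfl, rfl⟩, h₁⟩ | ⟨e₁, e₂, x, a, c, ⟨rfl, rfl⟩, h, h₂⟩ |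
      ⟨e₁, σ, τ, ⟨rfl, hσ, hτ⟩, h₁⟩ | ⟨x, a, ⟨rfl, rfl, hf⟩, h⟩ | ⟨e₁, rfl, g, h₁, rfl⟩ |
      ⟨i, j, x, a, ⟨rfl, rfl, hi, hj⟩, h⟩)
    · exact .s1 ..
    · exact .s2 ..
    · exact .s3 ..
    · exact .s4 _ _ _ _ c _ h₂ h₁
    · exact .s5_zero _ _ _ _ _ h₁
    · exact .s5_succ _ _ _ _ _ c _ h h₂
    · exact .s6 _ _ _ _ _ _ hσ hτ h₁
    · match f, hf with
      | g :: f, _ =>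
        obtain rfl : g x = b := h
        exact .s7 ..
    · exact .s8 _ _ _ _ h₁
    · exact .s9 _ _ _ _ _ _ hi hj h

/-- All sections of `R` obtained by fixing the number entries are Suslin sets. -/
def HasSuslinSections (R : Set CompSeq) : Prop :=
  ∀ (k e : ℕ) (a : List ℕ) (b : ℕ),
    IsSuslinSet {f : Fin k → (ℕ → ℕ) | ⟨e, a, List.ofFn f, b⟩ ∈ R}

theorem continuous_ofFn_getD (k i : ℕ) :
    Continuous fun f : Fin k → (ℕ → ℕ) => (List.ofFn f).getD i 0 := by
  by_cases h : i < k
  · simpa [List.getD_eq_getElem?_getD, List.getElem?_ofFn, h] using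
      continuous_apply (⟨i, h⟩ : Fin k)
  · simpa [List.getD_eq_getElem?_getD, List.getElem?_ofFn, h] using continuous_const

/-- Selecting coordinates is a continuous map `(ℕ → ℕ)^k → (ℕ → ℕ)^τ.length`, so the set is a
preimage of a section of `R`. -/
theorem HasSuslinSections.map_getD {R : Set CompSeq} (hR : HasSuslinSections R) (k e : ℕ)
    (a τ : List ℕ) (b : ℕ) :
    IsSuslinSet {f : Fin k → (ℕ → ℕ) |
      ⟨e, a, τ.map (fun i => (List.ofFn f).getD i 0), b⟩ ∈ R} := by
  have hφ : Continuous fun (f : Fin k → (ℕ → ℕ)) (j : Fin τ.length) =>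
      (List.ofFn f).getD (τ.get j) 0 :=
    continuous_pi fun j => continuous_ofFn_getD k _
  have key : ∀ f : Fin k → (ℕ → ℕ), τ.map (fun i => (List.ofFn f).getD i 0) =
      List.ofFn fun j : Fin τ.length => (List.ofFn f).getD (τ.get j) 0 := fun f =>
    List.ext_getElem (by simp) (by simp)
  simp only [key]
  exact (hR τ.length e a b).preimage hφ

theorem HasSuslinSections.take {R : Set CompSeq} (hR : HasSuslinSections R) (k e : ℕ)
    (a : List ℕ) (b : ℕ) {j : ℕ} (hj : j ≤ k) :
    IsSuslinSet {f : Fin k → (ℕ → ℕ) | ⟨e, a, (List.ofFn f).take j, b⟩ ∈ R} := by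
  have key : ∀ f : Fin k → (ℕ → ℕ), (List.ofFn f).take j =
      (List.range j).map fun i => (List.ofFn f).getD i 0 := fun f =>
    List.ext_getElem (by simpa using hj) fun i hi _ => by
      have : i < k := by simp at hi; omega
      simp [List.getD_eq_getElem?_getD, List.getElem?_ofFn, this]
  simpa only [key] using hR.map_getD k e a (List.range j) b

theorem HasSuslinSections.kleeneStep {R : Set CompSeq} (hR : HasSuslinSections R) :
    HasSuslinSections {x | KleeneStep R x} := by
  intro k e a b
  simp only [Set.mem_ofPred_eq, kleeneStep_iff, List.length_ofFn]
  refine .or (.const _) (.or ?_ (.or ?_ (.or ?_ (.or ?_ (.or ?_ (.or ?_ ?_))))))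
  · exact .exists_countable fun e₁ => .exists_countable fun e₂ => .exists_countable fun c =>
      .and (.const _) (.and (hR ..) (hR ..))
  · exact .exists_countable fun e₁ => .exists_countable fun e₂ => .exists_countable fun a' =>
      .and (.const _) (hR ..)
  · exact .exists_countable fun e₁ => .exists_countable fun e₂ => .exists_countable fun x =>
      .exists_countable fun a' => .exists_countable fun c =>
        .and (.const _) (.and (hR ..) (hR ..))
  · exact .exists_countable fun e₁ => .exists_countable fun σ => .exists_countable fun τ =>
      .and (.const _) (hR.map_getD ..)
  · exact .exists_countable fun x => .exists_countable fun a' => .and (.const _) <|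
      .of_isClopen <| (isClopen_discrete {b}).preimage <|
        (continuous_apply x).comp (continuous_ofFn_getD k 0)
  -- S8: the function `g` is eliminated before any closure property applies.
  · refine .exists_countable fun e₁ => .and (.const _) ?_
    have key := fun f : Fin k → (ℕ → ℕ) => exists_suslinFunctional_eq_iff (b := b)
      (V := fun x c => ⟨e₁, x :: a, List.ofFn f, c⟩ ∈ R)
    simp only [key]
    exact .and
      (.forall_countable fun x => .exists_countable fun c => hR ..) <| .or
        (.and (.const _) (.forall_branch (p := fun n f => ⟨e₁, n :: a, List.ofFn f, 0⟩ ∈ R)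
          fun n => hR ..))
        (.and (.const _) (.exists_branch
          (p := fun n f => ∃ c, ⟨e₁, n :: a, List.ofFn f, c + 1⟩ ∈ R)
          fun n => .exists_countable fun c => hR ..))
  · refine .exists_countable fun i => .exists_countable fun j => .exists_countable fun x =>
      .exists_countable fun a' => ?_
    by_cases hj : j ≤ k
    · exact .and (.const _) (hR.take _ _ _ _ hj)
    -- The side condition of S9 fails here, so the set is empty.
    · simpa [hj] using IsSuslinSet.const (X := Fin k → (ℕ → ℕ)) False

theorem countable_Iio_of_card_le_aleph0 {α : Ordinal.{0}} (hα : α.card ≤ Cardinal.aleph0) :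
    Countable (Set.Iio α) := by
  rw [← Cardinal.mk_le_aleph0_iff, Cardinal.mk_Iio_ordinal]
  exact Cardinal.lift_le_aleph0.2 hα

/-- Countability of `α` enters here: the union over `β < α` is countable. -/
theorem hasSuslinSections_exists_lt {α : Ordinal.{0}} (hα : α.card ≤ Cardinal.aleph0)
    (h : ∀ β < α, HasSuslinSections (OmegaStage β)) :
    HasSuslinSections {y | ∃ β < α, y ∈ OmegaStage β} := by
  intro k e a b
  have := countable_Iio_of_card_le_aleph0 hα
  have := IsSuslinSet.exists_countable
    (p := fun (β : Set.Iio α) (f : Fin k → (ℕ → ℕ)) => ⟨e, a, List.ofFn f, b⟩ ∈ OmegaStage β)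
    fun β => h β β.2 k e a b
  simpa using this

theorem hasSuslinSections_omegaStage (α : Ordinal.{0}) (hα : α.card ≤ Cardinal.aleph0) :
    HasSuslinSections (OmegaStage α) := by
  induction α using WellFoundedLT.induction with
  | ind α ih =>
    have := (hasSuslinSections_exists_lt hα fun β hβ =>
      ih β hβ ((Ordinal.card_le_card hβ.le).trans hα)).kleeneStep
    rwa [show OmegaStage α = {x | KleeneStep {y | ∃ β < α, y ∈ OmegaStage β} x} from
      Set.ext fun _ => mem_omegaStage_iff]

theorem mainTheorem6 (α : Ordinal.{0}) (hα : α.card ≤ Cardinal.aleph0)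
    (e k : ℕ) (a : List ℕ) (b : ℕ) :
    IsSuslinSet {f : Fin k → (ℕ → ℕ) | rankS ⟨e, a, List.ofFn f, b⟩ < (α : WithTop Ordinal.{0})} := by
  simp only [rankS_lt_coe_iff]
  exact hasSuslinSections_exists_lt hα (fun β hβ => hasSuslinSections_omegaStage β
    ((Ordinal.card_le_card hβ.le).trans hα)) k e a b
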